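/- Let $k=\mathbb F_q$ be a finite field and let $X\subseteq\mathbb P^2_k$ be a projective plane curve, i.e. an integral closed subscheme of dimension $1$. Let $\pi:\widetilde X\to X$ be the normalisation of $X$ (in its function field), and let $S$ be the singular subscheme of $X$, i.e. the closed set of points of $X$ whose local ring is not regular, with its reduced scheme structure. Let $Z$ be any (locally closed) subscheme of $X$ containing $S$, and let $\widetilde Z=\pi^{-1}(Z)=\widetilde X\times_X Z$. For a $k$-scheme $W$ write $W(\mathbb F_{q^r})$ for the set of morphisms of $k$-schemes $\operatorname{Spec}\mathbb F_{q^r}\to W$. Then for every integer $r\ge 1$ the sets $\widetilde X(\mathbb F_{q^r})$, $X(\mathbb F_{q^r})$, $\widetilde Z(\mathbb F_{q^r})$, $Z(\mathbb F_{q^r})$ are finite and \[ |\widetilde X(\mathbb F_{q^r})|-|X(\mathbb F_{q^r})| = |\widetilde Z(\mathbb F_{q^r})|-|Z(\mathbb F_{q^r})|. \] -/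

import Mathlib

open CategoryTheory CategoryTheory.Limits AlgebraicGeometry

universe u

noncomputable section

attribute [local instance] MvPolynomial.gradedAlgebra

/-- The projective plane `ℙ²` over a field `k`, as `Proj k[x₀, x₁, x₂]`. -/
abbrev projPlane (k : Type u) [Field k] : Scheme.{u} :=
  Proj (MvPolynomial.homogeneousSubmodule (Fin 3) k)

/-- The structure morphism `ℙ² ⟶ Spec k`. -/
def projPlaneToSpec (k : Type u) [Field k] : projPlane k ⟶ Spec (CommRingCat.of k) :=
  Proj.toSpecZero (MvPolynomial.homogeneousSubmodule (Fin 3) k) ≫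
    Spec.map (CommRingCat.ofHom
      (algebraMap k (MvPolynomial.homogeneousSubmodule (Fin 3) k 0)))

/-- The structure morphism `X ⟶ Spec k` of a scheme `e : X ⟶ ℙ²` over `ℙ²`. -/
def toSpecBase {k : Type u} [Field k] {X : Scheme.{u}} (e : X ⟶ projPlane k) :
    X ⟶ Spec (CommRingCat.of k) :=
  e ≫ projPlaneToSpec k

/-- The `L`-rational points of a `k`-scheme `s : X ⟶ Spec k`, for a `k`-algebra `L`:
the morphisms of `k`-schemes `Spec L ⟶ X`. -/
def RationalPoints {k : Type u} [Field k] {X : Scheme.{u}} (s : X ⟶ Spec (CommRingCat.of k))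
    (L : Type u) [Field L] [Algebra k L] : Type u :=
  {f : Spec (CommRingCat.of L) ⟶ X //
    f ≫ s = Spec.map (CommRingCat.ofHom (algebraMap k L))}

/-- The inclusion `Spec K(X) ⟶ X` of the generic point of an integral scheme. -/
abbrev genericPointMap (X : Scheme.{u}) [IsIntegral X] : Spec X.functionField ⟶ X :=
  X.fromSpecStalk (genericPoint X)

instance genericPointMap_quasiCompact (X : Scheme.{u}) [IsIntegral X] :
    QuasiCompact (genericPointMap X) := by
  have : Finite (Spec X.functionField) :=
    inferInstanceAs (Finite (PrimeSpectrum X.functionField))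
  exact ⟨fun U _ _ => (Set.toFinite _).isCompact⟩

instance genericPointMap_quasiSeparated (X : Scheme.{u}) [IsIntegral X] :
    QuasiSeparated (genericPointMap X) := by
  infer_instance

/-- The normalisation `X̃` of an integral scheme `X`: the normalisation of `X` in its function
field, that is, the gluing of the spectra of the integral closures of `Γ(X, U)` in `K(X)`, over
the affine opens `U` of `X`. -/
abbrev normalisation (X : Scheme.{u}) [IsIntegral X] : Scheme.{u} :=
  (genericPointMap X).normalization

/-- The normalisation morphism `π : X̃ ⟶ X`. -/
abbrev normalisationMap (X : Scheme.{u}) [IsIntegral X] : normalisation X ⟶ X :=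
  (genericPointMap X).fromNormalization

/-- The set of singular points of a scheme: those whose local ring is not regular. -/
def singularPoints (X : Scheme.{u}) : Set X :=
  {x | ¬ IsRegularLocalRing (X.presheaf.stalk x)}

/-- The ideal sheaf of the singular subscheme. (The closure only serves to produce a bundled closed
set: for schemes of finite type over a field the set of singular points is closed.) -/
def singularIdeal (X : Scheme.{u}) : X.IdealSheafData :=
  Scheme.IdealSheafData.vanishingIdeal
    (⟨closure (singularPoints X), isClosed_closure⟩ : TopologicalSpace.Closeds X)

/-- The singular subscheme of `X`: the closed set of singular points, with its reduced
scheme structure. -/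
abbrev singularSubscheme (X : Scheme.{u}) : Scheme.{u} :=
  (singularIdeal X).subscheme

/-- The inclusion of the singular subscheme. -/
abbrev singularSubschemeι (X : Scheme.{u}) : singularSubscheme X ⟶ X :=
  (singularIdeal X).subschemeι

end

/-! The map `π` is bijective on `L`-points over the regular locus of `X`, and `Z` contains every
singular point. So the discrepancy between the two point counts lives over `Z`; as immersions
identify the `L`-points of `Z` and `π⁻¹(Z)` with the points of `X` and `X̃` landing in them,
subtracting the complements gives the formula.

For bijectivity, work over an affine open with rings `A ⊆ B`, `B` the integral closure. A regular
local ring of dimension at most one is integrally closed, so each element of `B` is a fraction over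
`A` with denominator nonzero at the given point. A homomorphism from `A` to a field then extends
uniquely to `B`.

Finiteness of `X(L)` comes from finite type. For `X̃(L)`, finiteness of `π` is not invoked: a
counting version of Krull–Akizuki makes `B ⧸ aB` finite for nonzero `a` in `A`, which bounds the
fibres of `π` on `L`-points. -/

section Algebra

variable {A : Type*} [CommRing A]

/-! ### Finite quotients: Krull–Akizuki by counting -/

/-- Multiplication by `a ≠ 0` has the same index on every nonzero ideal of finite index of a
domain. -/
lemma Ideal.relIndex_map_mulLeft [IsDomain A] {a : A} (ha : a ≠ 0) (I : Ideal A)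
    (hI : I.toAddSubgroup.index ≠ 0) :
    (I.toAddSubgroup.map (AddMonoidHom.mulLeft a)).relIndex I.toAddSubgroup =
      (Ideal.span {a}).toAddSubgroup.index := by
  have hinj : Function.Injective (AddMonoidHom.mulLeft a) := mul_right_injective₀ ha
  have hle : I.toAddSubgroup.map (AddMonoidHom.mulLeft a) ≤ I.toAddSubgroup := by
    rintro _ ⟨x, hx, rfl⟩
    exact I.mul_mem_left a hx
  have htop : (⊤ : AddSubgroup A).map (AddMonoidHom.mulLeft a) =
      (Ideal.span {a}).toAddSubgroup := by
    ext x
    simp only [AddSubgroup.mem_map, AddSubgroup.mem_top, true_and, Submodule.mem_toAddSubgroup,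
      Ideal.mem_span_singleton, AddMonoidHom.coe_mulLeft, Dvd.dvd, eq_comm]
  have hle' : I.toAddSubgroup.map (AddMonoidHom.mulLeft a) ≤ (Ideal.span {a}).toAddSubgroup := by
    rw [← htop]
    exact AddSubgroup.map_mono le_top
  -- Compute `[A : aI]` through `I` and through `aA`. Since `[aA : aI] = [A : I]` is nonzero, it
  -- cancels.
  have h₁ := AddSubgroup.relIndex_mul_index hle
  have h₂ := AddSubgroup.relIndex_mul_index hle'
  rw [← htop, AddSubgroup.relIndex_map_map_of_injective _ _ hinj, AddSubgroup.relIndex_top_right,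
    htop] at h₂
  rw [← h₂, mul_comm] at h₁
  exact mul_left_cancel₀ hI h₁

/-- The counting form of the theorem of Krull and Akizuki: if every element of the domain `B` has
a nonzero multiple in the image of `A`, then `B ⧸ a B` is finite. -/
theorem Ideal.finite_quotient_span_of_exists_mul_mem_range [IsDomain A] {B : Type*} [CommRing B]
    [IsDomain B] (θ : A →+* B) (hθ : Function.Injective θ)
    (hfrac : ∀ b : B, ∃ d ≠ 0, ∃ c, θ d * b = θ c)
    (hfin : ∀ d : A, d ≠ 0 → Finite (A ⧸ Ideal.span {d})) {a : A} (ha : a ≠ 0) :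
    Finite (B ⧸ Ideal.span {θ a}) := by
  by_contra hinf
  rw [not_finite_iff_infinite] at hinf
  set N := (Ideal.span {a}).toAddSubgroup.index with hN
  -- Pigeonhole: lift `N + 1` distinct classes to `b i`, clear denominators by a common `d`, and
  -- compare the `c i = d * b i` modulo `aI`, which has index only `N` in `I`.
  obtain ⟨e⟩ : Nonempty (Fin (N + 1) ↪ B ⧸ Ideal.span {θ a}) :=
    ⟨(Fin.valEmbedding).trans (Infinite.natEmbedding _)⟩
  choose b hb using fun i ↦ Ideal.Quotient.mk_surjective (e i)
  obtain ⟨d, hd, hdb⟩ : ∃ d ≠ 0, ∀ i, ∃ c, θ d * b i = θ c := by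
    choose d hd c hc using hfrac
    refine ⟨∏ i, d (b i), Finset.prod_ne_zero_iff.mpr fun i _ ↦ hd _, fun i ↦ ?_⟩
    refine ⟨(∏ j ∈ Finset.univ.erase i, d (b j)) * c (b i), ?_⟩
    rw [← Finset.prod_erase_mul _ _ (Finset.mem_univ i), map_mul, map_mul, mul_assoc, hc]
  choose c hc using hdb
  -- The generator `d` guarantees that `I` has finite index.
  set I : Ideal A := Ideal.span ({d} ∪ Set.range c) with hIdef
  have hdI : Ideal.span {d} ≤ I := Ideal.span_mono Set.subset_union_left
  have hcI (i) : c i ∈ I := Ideal.subset_span (Or.inr ⟨i, rfl⟩)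
  have hdfin : (Ideal.span {d}).toAddSubgroup.index ≠ 0 := by
    have := hfin d hd
    have : Finite (A ⧸ (Ideal.span {d}).toAddSubgroup) := this
    exact AddSubgroup.index_ne_zero_of_finite
  have hI : I.toAddSubgroup.index ≠ 0 := fun h ↦
    hdfin (Nat.eq_zero_of_zero_dvd (h ▸ AddSubgroup.index_dvd_of_le
      (H := (Ideal.span {d}).toAddSubgroup) (K := I.toAddSubgroup) hdI))
  have hIB : ∀ x ∈ I, ∃ y, θ x = θ d * y := by
    intro x hx
    have : I ≤ (Ideal.span {θ d}).comap θ := by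
      rw [hIdef, Ideal.span_le]
      rintro x (rfl | ⟨i, rfl⟩)
      · exact Ideal.mem_span_singleton_self _
      · exact Ideal.mem_span_singleton.mpr ⟨b i, (hc i).symm⟩
    exact Ideal.mem_span_singleton.mp (this hx)
  have hNpos : N ≠ 0 := by
    have := hfin a ha
    have : Finite (A ⧸ (Ideal.span {a}).toAddSubgroup) := this
    exact AddSubgroup.index_ne_zero_of_finite
  have hcard := Ideal.relIndex_map_mulLeft ha I hI
  rw [← hN, AddSubgroup.relIndex, AddSubgroup.index] at hcard
  set H := (I.toAddSubgroup.map (AddMonoidHom.mulLeft a)).addSubgroupOf I.toAddSubgroup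
  have : Finite (I.toAddSubgroup ⧸ H) := Nat.finite_of_card_ne_zero (hcard ▸ hNpos)
  obtain ⟨i, j, hij, h⟩ : ∃ i j, i ≠ j ∧
      (QuotientAddGroup.mk (⟨c i, hcI i⟩ : I.toAddSubgroup) : I.toAddSubgroup ⧸ H) =
        QuotientAddGroup.mk ⟨c j, hcI j⟩ := by
    have := Fintype.ofFinite (I.toAddSubgroup ⧸ H)
    refine Fintype.exists_ne_map_eq_of_card_lt
      (fun i ↦ (QuotientAddGroup.mk (⟨c i, hcI i⟩ : I.toAddSubgroup) : I.toAddSubgroup ⧸ H)) ?_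
    rw [← Nat.card_eq_fintype_card, hcard]
    simp
  rw [QuotientAddGroup.eq] at h
  obtain ⟨y, hy, hyc⟩ := AddSubgroup.mem_addSubgroupOf.mp h
  -- As `I ⊆ dB`, the difference of the two `c`'s is `a * d * z`; cancelling `d` makes the two `b`'s
  -- congruent modulo `aB`.
  obtain ⟨z, hz⟩ := hIB y hy
  refine hij (e.injective ?_)
  rw [← hb, ← hb, Ideal.Quotient.eq, ← neg_mem_iff]
  refine Ideal.mem_span_singleton.mpr ⟨z, mul_left_cancel₀ ((map_ne_zero_iff θ hθ).mpr hd) ?_⟩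
  have h' : a * y = -c i + c j := hyc
  have := congrArg θ h'
  rw [map_mul, hz, map_add, map_neg, ← hc, ← hc] at this
  linear_combination -this

/-- A nonzero principal ideal of a one-dimensional domain of finite type over a finite field has
finite index. -/
lemma Ideal.finite_quotient_span_of_finiteType (k : Type*) [Field k] [Finite k] [Algebra k A]
    [IsDomain A] [Algebra.FiniteType k A] (hdim : ringKrullDim A ≤ 1) {d : A} (hd : d ≠ 0) :
    Finite (A ⧸ Ideal.span {d}) := by
  have : Ring.KrullDimLE 0 (A ⧸ Ideal.span {d}) := by
    rw [Ring.krullDimLE_iff]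
    have h := (ringKrullDim_quotient_succ_le_of_nonZeroDivisor
      (mem_nonZeroDivisors_of_ne_zero hd)).trans hdim
    exact ENat.WithBot.add_le_add_one_right_iff.mp (by simpa using h)
  have : Module.Finite k (A ⧸ Ideal.span {d}) := (Module.finite_iff_krullDimLE_zero k _).mpr this
  exact Module.finite_of_finite k

/-! ### Extending homomorphisms to a field -/

/-- Uniqueness of extensions to a field. -/
lemma RingHom.ext_of_exists_mul_mem_range {B L : Type*} [CommRing B] [Field L] (θ : A →+* B)
    (φ : A →+* L) (h : ∀ b, ∃ s a, φ s ≠ 0 ∧ θ s * b = θ a) {ψ ψ' : B →+* L}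
    (hψ : ψ.comp θ = φ) (hψ' : ψ'.comp θ = φ) : ψ = ψ' := by
  ext b
  obtain ⟨s, a, hs, hab⟩ := h b
  refine mul_left_cancel₀ hs ?_
  have h₁ := congrArg ψ hab
  have h₂ := congrArg ψ' hab
  simp only [map_mul, ← RingHom.comp_apply, hψ, hψ'] at h₁ h₂
  rw [h₁, h₂]

/-- Existence of extensions to a field. -/
lemma RingHom.exists_comp_eq_of_exists_mul_mem_range {B L : Type*} [CommRing B] [Field L]
    (θ : A →+* B) (hθ : Function.Injective θ) (φ : A →+* L)
    (h : ∀ b, ∃ s a, φ s ≠ 0 ∧ θ s * b = θ a) : ∃ ψ : B →+* L, ψ.comp θ = φ := by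
  choose s a hs hsa using h
  -- The value of a fraction does not depend on how it is written; this yields every ring axiom
  -- below.
  have key (b : B) (t c : A) (ht : φ t ≠ 0) (htc : θ t * b = θ c) :
      φ (a b) / φ (s b) = φ c / φ t := by
    rw [div_eq_div_iff (hs b) ht, ← map_mul, ← map_mul]
    congr 1
    apply hθ
    rw [map_mul, map_mul, ← hsa, ← htc]
    ring
  refine ⟨{ toFun b := φ (a b) / φ (s b)
            map_one' := ?_, map_mul' := fun b b' ↦ ?_, map_zero' := ?_,
            map_add' := fun b b' ↦ ?_ }, ?_⟩
  · rw [key 1 1 1 (by simp) (by simp)]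
    simp
  · rw [key (b * b') (s b * s b') (a b * a b') (by simp [hs])
      (by rw [map_mul, map_mul, ← hsa, ← hsa]; ring), map_mul, map_mul, div_mul_div_comm]
  · rw [key 0 1 0 (by simp) (by simp)]
    simp
  · rw [key (b + b') (s b * s b') (a b * s b' + a b' * s b) (by simp [hs])
      (by rw [map_mul, map_add, map_mul, map_mul, ← hsa, ← hsa]; ring), map_mul, map_add, map_mul,
      map_mul, div_add_div _ _ (hs b) (hs b'), mul_comm (φ (a b')) (φ (s b))]
  · ext x
    have := key (θ x) 1 x (by simp) (by simp)
    simpa using this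

/-- Over a one-dimensional domain of finite type over a finite field, homomorphisms to a finite
field have finitely many extensions to a ring of fractions. -/
theorem finite_setOf_ringHom_comp_eq (k : Type*) [Field k] [Finite k] [Algebra k A]
    [IsDomain A] [Algebra.FiniteType k A] (hdim : ringKrullDim A ≤ 1)
    {B L : Type*} [CommRing B] [IsDomain B] [Field L] [Finite L] (θ : A →+* B)
    (hθ : Function.Injective θ) (hfrac : ∀ b : B, ∃ d ≠ 0, ∃ c, θ d * b = θ c) (φ : A →+* L) :
    Finite {ψ : B →+* L // ψ.comp θ = φ} := by
  by_cases hφ : Function.Injective φ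
  · have : Subsingleton {ψ : B →+* L // ψ.comp θ = φ} := by
      refine ⟨fun ψ ψ' ↦ Subtype.ext
        (RingHom.ext_of_exists_mul_mem_range θ φ (fun b ↦ ?_) ψ.2 ψ'.2)⟩
      obtain ⟨d, hd, c, hc⟩ := hfrac b
      exact ⟨d, c, (map_ne_zero_iff φ hφ).mpr hd, hc⟩
    infer_instance
  · obtain ⟨a, haφ, ha⟩ : ∃ a, φ a = 0 ∧ a ≠ 0 := by
      simpa [injective_iff_map_eq_zero] using hφ
    have := Ideal.finite_quotient_span_of_exists_mul_mem_range θ hθ hfrac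
      (fun d hd ↦ Ideal.finite_quotient_span_of_finiteType k hdim hd) ha
    -- Every extension kills `θ a`, so it is a function from the finite ring `B ⧸ aB` to `L`.
    let F : {ψ : B →+* L // ψ.comp θ = φ} → (B ⧸ Ideal.span {θ a} → L) := fun ψ ↦
      Ideal.Quotient.lift _ ψ.1 fun x hx ↦ by
        obtain ⟨y, rfl⟩ := Ideal.mem_span_singleton.mp hx
        rw [map_mul, ← RingHom.comp_apply, ψ.2, haφ, zero_mul]
    refine Finite.of_injective F fun ψ ψ' h ↦ Subtype.ext (RingHom.ext fun b ↦ ?_)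
    simpa [F] using congrFun h (Ideal.Quotient.mk _ b)

/-! ### Denominators at normal and regular points -/

/-- Denominators at a prime at which `A` is integrally closed. -/
lemma exists_mul_mem_range_of_isIntegrallyClosed [IsDomain A] {B : Type*} [CommRing B]
    [IsDomain B] (θ : A →+* B) (hθ : Function.Injective θ) (hint : θ.IsIntegral)
    (hfrac : ∀ b : B, ∃ d ≠ 0, ∃ c, θ d * b = θ c) (p : Ideal A) [p.IsPrime]
    (S : Type*) [CommRing S] [IsDomain S] [Algebra A S] [IsLocalization.AtPrime S p]
    [IsIntegrallyClosed S] (b : B) : ∃ s a, s ∉ p ∧ θ s * b = θ a := by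
  obtain ⟨d, hd, c, hc⟩ := hfrac b
  have hAS : Function.Injective (algebraMap A S) :=
    IsLocalization.injective S p.primeCompl_le_nonZeroDivisors
  let K := FractionRing S
  have hAK : Function.Injective (algebraMap A K) := by
    rw [IsScalarTower.algebraMap_eq A S K]
    exact (IsFractionRing.injective S K).comp hAS
  have hdK : algebraMap A K d ≠ 0 := (map_ne_zero_iff _ hAK).mpr hd
  set x : K := algebraMap A K c / algebraMap A K d with hx
  have hxint : IsIntegral A x := by
    obtain ⟨f, hf, hfb⟩ := hint b
    refine ⟨f, hf, ?_⟩
    -- Clearing denominators carries the integral equation of `b` from `B` through `A` to `x = c /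
    -- d` in `K`, without a map between `B` and `K`.
    have h₁ : (f.scaleRoots d).eval c = 0 := by
      apply hθ
      rw [map_zero, ← Polynomial.eval₂_at_apply, ← hc,
        Polynomial.scaleRoots_eval₂_eq_zero θ hfb]
    have h₂ := Polynomial.scaleRoots_eval₂_mul (p := f) (algebraMap A K) x d
    rw [hx, mul_div_cancel₀ _ hdK, Polynomial.eval₂_at_apply, h₁, map_zero, eq_comm] at h₂
    exact (mul_eq_zero.mp h₂).resolve_left (pow_ne_zero _ hdK)
  obtain ⟨y, hy⟩ := IsIntegrallyClosed.isIntegral_iff.mp (hxint.tower_top (A := S))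
  obtain ⟨⟨a, s⟩, hs⟩ := IsLocalization.surj p.primeCompl y
  refine ⟨s, a, s.2, ?_⟩
  have h : (s : A) * c = d * a := by
    apply hAK
    have := congrArg (algebraMap S K) hs
    rw [map_mul, hy, ← IsScalarTower.algebraMap_apply, ← IsScalarTower.algebraMap_apply, hx,
      div_mul_eq_mul_div, div_eq_iff hdK] at this
    rw [map_mul, map_mul]
    linear_combination this
  refine mul_left_cancel₀ ((map_ne_zero_iff θ hθ).mpr hd) ?_
  rw [← map_mul, ← h, map_mul, ← hc]
  ring

open IsLocalRing in
/-- A regular local domain of dimension at most one is integrally closed. -/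
lemma IsRegularLocalRing.isIntegrallyClosed_of_ringKrullDim_le_one (R : Type*) [CommRing R]
    [IsDomain R] [IsRegularLocalRing R] (h : ringKrullDim R ≤ 1) : IsIntegrallyClosed R := by
  have h₁ := (IsRegularLocalRing.iff_finrank_cotangentSpace R).mp inferInstance
  have h₂ : Module.finrank (ResidueField R) (CotangentSpace R) ≤ 1 := by
    rw [← h₁] at h
    exact_mod_cast h
  have h₃ := (tfae_of_isNoetherianRing_of_isLocalRing_of_isDomain R).out 5 3
  exact (h₃.mp h₂).1

end Algebra

/-! ### Field-valued points and the normalisation -/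

section Schemes

open IsLocalRing

/-- A field-valued point factors through a preimmersion if its image is in the range. -/
lemma AlgebraicGeometry.IsPreimmersion.exists_comp_eq {Z X : Scheme.{u}} (i : Z ⟶ X)
    [IsPreimmersion i] {L : Type u} [Field L] (f : Spec (CommRingCat.of L) ⟶ X)
    (hf : f (closedPoint L) ∈ Set.range i) : ∃ g, g ≫ i = f := by
  obtain ⟨z, hz⟩ := hf
  -- Surjectivity on stalks makes the residue field map an isomorphism, so a point through `Spec κ(i
  -- z)` lifts to `Z`.
  have hsurj : Function.Surjective (i.residueFieldMap z) := by
    intro y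
    obtain ⟨y, rfl⟩ := Z.residue_surjective z y
    obtain ⟨y, rfl⟩ := i.stalkMap_surjective z y
    exact ⟨X.residue _ y, congr($(Scheme.residue_residueFieldMap i z) y)⟩
  have : IsIso (i.residueFieldMap z) :=
    (ConcreteCategory.isIso_iff_bijective _).mpr ⟨RingHom.injective _, hsurj⟩
  obtain ⟨h, hh⟩ : ∃ h : Spec (CommRingCat.of L) ⟶ Spec (X.residueField (i z)),
      h ≫ X.fromSpecResidueField (i z) = f := by
    rw [hz]
    exact ⟨_, Scheme.descResidueField_stalkClosedPointTo_fromSpecResidueField L X f⟩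
  refine ⟨h ≫ inv (Spec.map (i.residueFieldMap z)) ≫ Z.fromSpecResidueField z, ?_⟩
  rw [Category.assoc, Category.assoc, ← Scheme.Hom.SpecMap_residueFieldMap_fromSpecResidueField,
    IsIso.inv_hom_id_assoc, hh]

/-- A point with values in a local ring whose closed point lies in an affine open. -/
lemma AlgebraicGeometry.IsAffineOpen.exists_specMap_fromSpec {X : Scheme.{u}} {U : X.Opens}
    (hU : IsAffineOpen U) {L : Type u} [Field L] (f : Spec (CommRingCat.of L) ⟶ X)
    (hf : f (closedPoint L) ∈ U) :
    ∃ φ : Γ(X, U) ⟶ CommRingCat.of L, Spec.map φ ≫ hU.fromSpec = f := by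
  have hr : Set.range f ⊆ Set.range hU.fromSpec := by
    rintro _ ⟨y, rfl⟩
    rw [hU.range_fromSpec, Subsingleton.elim y (closedPoint L)]
    exact hf
  obtain ⟨φ, hφ⟩ := Spec.map_surjective (IsOpenImmersion.lift hU.fromSpec f hr)
  exact ⟨φ, by rw [hφ, IsOpenImmersion.lift_fac]⟩

/-- The ring homomorphism of a point in an affine open does not vanish off the prime of its
image. -/
lemma AlgebraicGeometry.IsAffineOpen.map_ne_zero_of_notMem_primeIdealOf {X : Scheme.{u}}
    {U : X.Opens} (hU : IsAffineOpen U) {L : Type u} [Field L] (φ : Γ(X, U) ⟶ CommRingCat.of L)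
    (x : U) (hx : (Spec.map φ ≫ hU.fromSpec) (closedPoint L) = x) {s : Γ(X, U)}
    (hs : s ∉ (hU.primeIdealOf x).asIdeal) : φ s ≠ 0 := by
  have h : hU.primeIdealOf x = Spec.map φ (closedPoint L) := by
    apply hU.fromSpec.injective
    rw [hU.fromSpec_primeIdealOf, ← hx]
    rfl
  rw [h] at hs
  intro h0
  refine hs ?_
  change φ s ∈ maximalIdeal L
  rw [h0]
  exact zero_mem _

/-- Lifts of a point along an affine morphism are extensions of ring homomorphisms. -/
lemma AlgebraicGeometry.IsAffineOpen.specMap_fromSpec_comp_eq_iff {X Y : Scheme.{u}} (π : Y ⟶ X)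
    {U : X.Opens} (hU : IsAffineOpen U) (hV : IsAffineOpen (π ⁻¹ᵁ U)) {R : CommRingCat.{u}}
    (φ : Γ(X, U) ⟶ R) (ψ : Γ(Y, π ⁻¹ᵁ U) ⟶ R) :
    (Spec.map ψ ≫ hV.fromSpec) ≫ π = Spec.map φ ≫ hU.fromSpec ↔ π.app U ≫ ψ = φ := by
  rw [Category.assoc, ← IsAffineOpen.SpecMap_appLE_fromSpec π hU hV le_rfl, ← Category.assoc,
    cancel_mono, ← Spec.map_comp, Spec.map_inj, Scheme.Hom.app_eq_appLE]

/-- The function field is the ring of sections of its spectrum over the preimage of an open set, so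
the latter is a ring of fractions of the sections over an affine open. -/
lemma genericPointMap_app_properties (X : Scheme.{u}) [IsIntegral X] {U : X.Opens}
    (hU : IsAffineOpen U) [Nonempty U] :
    IsDomain Γ(Spec X.functionField, genericPointMap X ⁻¹ᵁ U) ∧
    Function.Injective ((genericPointMap X).app U).hom ∧
    ∀ b, ∃ d ≠ 0, ∃ c, ((genericPointMap X).app U).hom d * b =
      ((genericPointMap X).app U).hom c := by
  have hx : genericPoint X ∈ U :=
    ((genericPoint_spec X).mem_open_set_iff U.isOpen).mpr (by simpa using ‹Nonempty U›)
  have htop : genericPointMap X ⁻¹ᵁ U = ⊤ := by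
    refine Scheme.preimage_eq_top_of_closedPoint_mem (R := X.functionField) _ ?_
    rwa [Scheme.fromSpecStalk_closedPoint]
  have : IsIso ((Spec X.functionField).presheaf.map
      (homOfLE (le_top (a := genericPointMap X ⁻¹ᵁ U))).op) := by
    rw [Subsingleton.elim (homOfLE (le_top (a := genericPointMap X ⁻¹ᵁ U))) (eqToHom htop)]
    infer_instance
  let e := (Scheme.ΓSpecIso X.functionField).symm ≪≫ asIso
    ((Spec X.functionField).presheaf.map (homOfLE (le_top (a := genericPointMap X ⁻¹ᵁ U))).op)
  let E : X.functionField ≃+* Γ(Spec X.functionField, genericPointMap X ⁻¹ᵁ U) :=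
    e.commRingCatIsoToRingEquiv
  have happ (a) : ((genericPointMap X).app U).hom a = E (algebraMap Γ(X, U) X.functionField a) :=
    congr($(Scheme.fromSpecStalk_app hx) a)
  have := functionField_isFractionRing_of_isAffineOpen X U hU
  refine ⟨E.symm.toMulEquiv.isDomain _, fun a b hab ↦ ?_, fun b ↦ ?_⟩
  · rw [happ, happ] at hab
    exact IsFractionRing.injective Γ(X, U) X.functionField (E.injective hab)
  · obtain ⟨⟨c, d⟩, hcd⟩ := IsLocalization.surj (nonZeroDivisors Γ(X, U)) (E.symm b)
    refine ⟨d, nonZeroDivisors.ne_zero d.2, c, ?_⟩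
    rw [happ, happ, ← hcd, map_mul, E.apply_symm_apply, mul_comm]

/-- The sections of the normalisation over an affine open form an integral extension of the
sections of `X` inside the function field. -/
lemma normalisationMap_app_properties (X : Scheme.{u}) [IsIntegral X] {U : X.Opens}
    (hU : IsAffineOpen U) [Nonempty U] :
    IsDomain Γ(normalisation X, normalisationMap X ⁻¹ᵁ U) ∧
    Function.Injective ((normalisationMap X).app U).hom ∧
    ((normalisationMap X).app U).hom.IsIntegral ∧
    ∀ b, ∃ d ≠ 0, ∃ c, ((normalisationMap X).app U).hom d * b =
      ((normalisationMap X).app U).hom c := by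
  obtain ⟨hdom, hinj, hfrac⟩ := genericPointMap_app_properties X hU
  let _ := ((genericPointMap X).app U).hom.toAlgebra
  let e : Γ(normalisation X, normalisationMap X ⁻¹ᵁ U) ≃+*
      integralClosure Γ(X, U) Γ(Spec X.functionField, genericPointMap X ⁻¹ᵁ U) :=
    ((genericPointMap X).normalizationObjIso hU).commRingCatIsoToRingEquiv
  have happ (a) : ((normalisationMap X).app U).hom a = e.symm (algebraMap Γ(X, U) _ a) :=
    congr($((genericPointMap X).fromNormalization_app hU) a)
  refine ⟨e.toMulEquiv.isDomain _, fun a b hab ↦ ?_, ?_, fun b ↦ ?_⟩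
  · rw [happ, happ] at hab
    exact hinj congr(($(e.symm.injective hab)).1)
  · exact IsIntegralHom.isIntegral_app _ _ hU
  · obtain ⟨d, hd, c, hc⟩ := hfrac (e b).1
    refine ⟨d, hd, c, e.injective ?_⟩
    rw [happ, happ, map_mul, e.apply_symm_apply, e.apply_symm_apply]
    exact Subtype.ext hc

instance (k : Type u) [Field k] : Algebra.FiniteType
    (MvPolynomial.homogeneousSubmodule (Fin 3) k 0) (MvPolynomial (Fin 3) k) := by
  have : IsScalarTower k (MvPolynomial.homogeneousSubmodule (Fin 3) k 0)
      (MvPolynomial (Fin 3) k) := .mk fun a b c ↦ smul_mul_assoc a b.1 c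
  exact Algebra.FiniteType.of_restrictScalars_finiteType k _ _

instance (k : Type u) [Field k] : IsClosedImmersion (Spec.map (CommRingCat.ofHom
    (algebraMap k (MvPolynomial.homogeneousSubmodule (Fin 3) k 0)))) := by
  refine IsClosedImmersion.spec_of_surjective _ ?_
  rintro ⟨x, hx⟩
  rw [MvPolynomial.homogeneousSubmodule_zero] at hx
  obtain ⟨a, ha⟩ := Submodule.mem_one.mp hx
  exact ⟨a, Subtype.ext ha⟩

instance projPlaneToSpec_locallyOfFiniteType (k : Type u) [Field k] :
    LocallyOfFiniteType (projPlaneToSpec k) := by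
  unfold projPlaneToSpec
  infer_instance

instance projPlaneToSpec_quasiCompact (k : Type u) [Field k] :
    QuasiCompact (projPlaneToSpec k) := by
  unfold projPlaneToSpec
  infer_instance

/-- The ring of sections of a `k`-scheme of finite type over an affine open is a `k`-algebra of
finite type. -/
lemma AlgebraicGeometry.IsAffineOpen.exists_finiteType {k : Type u} [Field k] {X : Scheme.{u}}
    (s : X ⟶ Spec (CommRingCat.of k)) [LocallyOfFiniteType s] {U : X.Opens}
    (hU : IsAffineOpen U) :
    ∃ σ : CommRingCat.of k ⟶ Γ(X, U), σ.hom.FiniteType ∧ Spec.map σ = hU.fromSpec ≫ s := by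
  obtain ⟨σ, hσ⟩ := Spec.map_surjective (hU.fromSpec ≫ s)
  refine ⟨σ, ?_, hσ⟩
  rw [← HasRingHomProperty.Spec_iff (P := @LocallyOfFiniteType), hσ]
  infer_instance

/-- A scheme of finite type over a field has finitely many points with values in a finite
field. -/
lemma finite_rationalPoints {k : Type u} [Field k] {X : Scheme.{u}}
    (s : X ⟶ Spec (CommRingCat.of k)) [LocallyOfFiniteType s] [QuasiCompact s]
    (L : Type u) [Field L] [Finite L] [Algebra k L] : Finite (RationalPoints s L) := by
  have : CompactSpace X := (quasiCompact_iff_compactSpace s).mp inferInstance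
  obtain ⟨t, ht⟩ := isCompact_univ.elim_finite_subcover
    (fun U : X.affineOpens ↦ (U.1 : Set X)) (fun U ↦ U.1.2) fun x _ ↦ by
      have : x ∈ ⨆ U : X.affineOpens, (U : X.Opens) := by
        rw [iSup_affineOpens_eq_top]; trivial
      simpa using this
  choose σ hσ hσs using fun U : X.affineOpens ↦ U.2.exists_finiteType s
  have hfin (U : X.affineOpens) :
      Finite {φ : Γ(X, U) ⟶ CommRingCat.of L // σ U ≫ φ = CommRingCat.ofHom (algebraMap k L)} := by
    have := hσ U
    algebraize [(σ U).hom]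
    obtain ⟨S, hS⟩ := Algebra.FiniteType.out (R := k) (A := Γ(X, U))
    -- A `k`-algebra homomorphism is determined by its values on the finite generating set `S`.
    let F : {φ : Γ(X, U) ⟶ CommRingCat.of L //
        σ U ≫ φ = CommRingCat.ofHom (algebraMap k L)} → (S → L) := fun φ x ↦ φ.1 x
    refine Finite.of_injective F fun φ ψ h ↦ Subtype.ext (CommRingCat.hom_ext ?_)
    let φ' : Γ(X, U) →ₐ[k] L := ⟨φ.1.hom, fun a ↦ congr($(φ.2) a)⟩
    let ψ' : Γ(X, U) →ₐ[k] L := ⟨ψ.1.hom, fun a ↦ congr($(ψ.2) a)⟩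
    have : φ' = ψ' := AlgHom.ext_of_adjoin_eq_top hS fun x hx ↦ congrFun h ⟨x, hx⟩
    exact congr(($this : Γ(X, U) →+* L))
  let G : (Σ U : t, {φ : Γ(X, U.1) ⟶ CommRingCat.of L //
      σ U.1 ≫ φ = CommRingCat.ofHom (algebraMap k L)}) → RationalPoints s L := fun φ ↦
    ⟨Spec.map φ.2.1 ≫ φ.1.1.2.fromSpec, by
      rw [Category.assoc, ← hσs, ← Spec.map_comp, φ.2.2]⟩
  refine Finite.of_surjective G fun ⟨f, hf⟩ ↦ ?_
  obtain ⟨U, hUt, hxU⟩ : ∃ U ∈ t, f (closedPoint L) ∈ U.1 := by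
    simpa using ht (Set.mem_univ (f (closedPoint L)))
  obtain ⟨φ, rfl⟩ := U.2.exists_specMap_fromSpec f hxU
  refine ⟨⟨⟨U, hUt⟩, φ, Spec.map_injective ?_⟩, rfl⟩
  rw [← hf, Category.assoc, ← hσs, Spec.map_comp]

lemma AlgebraicGeometry.IsAffineOpen.ringKrullDim_le_topologicalKrullDim {X : Scheme.{u}}
    {U : X.Opens} (hU : IsAffineOpen U) : ringKrullDim Γ(X, U) ≤ topologicalKrullDim X := by
  rw [← PrimeSpectrum.topologicalKrullDim_eq_ringKrullDim]
  exact hU.fromSpec.isOpenEmbedding.isInducing.topologicalKrullDim_le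

/-- A point with regular image on an integral scheme of dimension at most one lifts uniquely to
the normalisation. -/
lemma existsUnique_comp_normalisationMap (X : Scheme.{u}) [IsIntegral X]
    (hdim : topologicalKrullDim X ≤ 1) {L : Type u} [Field L] (f : Spec (CommRingCat.of L) ⟶ X)
    (hf : f (closedPoint L) ∉ singularPoints X) : ∃! g, g ≫ normalisationMap X = f := by
  obtain ⟨_, ⟨U, hU, rfl⟩, hxU, -⟩ := X.isBasis_affineOpens.exists_subset_of_mem_open
    (Set.mem_univ (f (closedPoint L))) isOpen_univ
  replace hU : IsAffineOpen U := hU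
  have : Nonempty U := ⟨⟨_, hxU⟩⟩
  obtain ⟨hdom, hinj, hint, hfrac⟩ := normalisationMap_app_properties X hU
  have hV : IsAffineOpen (normalisationMap X ⁻¹ᵁ U) := hU.preimage _
  set x : U := ⟨f (closedPoint L), hxU⟩ with hx
  let _ := TopCat.Presheaf.algebra_section_stalk X.presheaf x
  have := hU.isLocalization_stalk x
  have hreg : IsRegularLocalRing (X.presheaf.stalk (x : X)) := not_not.mp hf
  have hdimx : ringKrullDim (X.presheaf.stalk (x : X)) ≤ 1 := by
    rw [IsLocalization.AtPrime.ringKrullDim_eq_height (hU.primeIdealOf x).asIdeal]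
    exact Ideal.height_le_ringKrullDim_of_isPrime.trans
      (hU.ringKrullDim_le_topologicalKrullDim.trans hdim)
  have := IsRegularLocalRing.isIntegrallyClosed_of_ringKrullDim_le_one _ hdimx
  obtain ⟨φ, hφ⟩ := hU.exists_specMap_fromSpec f hxU
  -- Regularity enters here: denominators can be chosen nonzero at the image point.
  have hden (b) : ∃ s a, φ.hom s ≠ 0 ∧ ((normalisationMap X).app U).hom s * b =
      ((normalisationMap X).app U).hom a := by
    obtain ⟨s, a, hs, hsa⟩ := exists_mul_mem_range_of_isIntegrallyClosed _ hinj hint hfrac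
      (hU.primeIdealOf x).asIdeal (X.presheaf.stalk (x : X)) b
    exact ⟨s, a, hU.map_ne_zero_of_notMem_primeIdealOf φ x (by rw [hφ]) hs, hsa⟩
  obtain ⟨ψ, hψ⟩ := RingHom.exists_comp_eq_of_exists_mul_mem_range _ hinj φ.hom hden
  refine ⟨Spec.map (CommRingCat.ofHom ψ) ≫ hV.fromSpec, ?_, fun g hg ↦ ?_⟩
  · dsimp only
    rw [← hφ, hU.specMap_fromSpec_comp_eq_iff _ hV]
    exact CommRingCat.hom_ext hψ
  · obtain ⟨ψ', rfl⟩ := hV.exists_specMap_fromSpec g (by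
      change (g ≫ normalisationMap X) (closedPoint L) ∈ U
      rwa [hg])
    rw [← hφ, hU.specMap_fromSpec_comp_eq_iff _ hV] at hg
    congr 2
    exact CommRingCat.hom_ext (RingHom.ext_of_exists_mul_mem_range _ φ.hom hden
      congr(($hg).hom) hψ)

/-- The normalisation map of a curve over a finite field has finite fibres on points with values in
a finite field. -/
lemma finite_comp_normalisationMap_eq {k : Type u} [Field k] [Finite k] (X : Scheme.{u})
    [IsIntegral X] (s : X ⟶ Spec (CommRingCat.of k)) [LocallyOfFiniteType s]
    (hdim : topologicalKrullDim X ≤ 1) {L : Type u} [Field L] [Finite L]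
    (f : Spec (CommRingCat.of L) ⟶ X) : Finite {g // g ≫ normalisationMap X = f} := by
  obtain ⟨_, ⟨U, hU, rfl⟩, hxU, -⟩ := X.isBasis_affineOpens.exists_subset_of_mem_open
    (Set.mem_univ (f (closedPoint L))) isOpen_univ
  replace hU : IsAffineOpen U := hU
  have : Nonempty U := ⟨⟨_, hxU⟩⟩
  obtain ⟨hdom, hinj, hint, hfrac⟩ := normalisationMap_app_properties X hU
  have hV : IsAffineOpen (normalisationMap X ⁻¹ᵁ U) := hU.preimage _
  obtain ⟨φ, hφ⟩ := hU.exists_specMap_fromSpec f hxU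
  obtain ⟨σ, hσ, -⟩ := hU.exists_finiteType s
  algebraize [σ.hom]
  have hdimU : ringKrullDim Γ(X, U) ≤ 1 := hU.ringKrullDim_le_topologicalKrullDim.trans hdim
  have := finite_setOf_ringHom_comp_eq k hdimU _ hinj hfrac φ.hom
  let G : {ψ : Γ(normalisation X, normalisationMap X ⁻¹ᵁ U) →+* L //
      ψ.comp ((normalisationMap X).app U).hom = φ.hom} →
      {g // g ≫ normalisationMap X = f} := fun ψ ↦
    ⟨Spec.map (CommRingCat.ofHom ψ.1) ≫ hV.fromSpec, by
      rw [← hφ, hU.specMap_fromSpec_comp_eq_iff _ hV]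
      exact CommRingCat.hom_ext ψ.2⟩
  refine Finite.of_surjective G fun ⟨g, hg⟩ ↦ ?_
  obtain ⟨ψ, rfl⟩ := hV.exists_specMap_fromSpec g (by
    change (g ≫ normalisationMap X) (closedPoint L) ∈ U
    rwa [hg])
  rw [← hφ, hU.specMap_fromSpec_comp_eq_iff _ hV] at hg
  exact ⟨⟨ψ.hom, congr(($hg).hom)⟩, rfl⟩

end Schemes

/-! ### Counting rational points -/

section Counting

open IsLocalRing

/-- A map with singleton fibres outside `T` changes the cardinality as much as its restriction
over `T`. -/
lemma natCard_sub_natCard_eq_of_existsUnique {α β : Type*} [Finite α] [Finite β] (p : α → β)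
    (T : Set β) (h : ∀ b ∉ T, ∃! a, p a = b) :
    (Nat.card α : ℤ) - Nat.card β = (p ⁻¹' T).ncard - T.ncard := by
  have hbij : Set.BijOn p (p ⁻¹' T)ᶜ Tᶜ := by
    refine ⟨fun a ha ↦ ha, fun a ha a' _ haa' ↦ ?_, fun b hb ↦ ?_⟩
    · exact (h (p a) ha).unique rfl haa'.symm
    · obtain ⟨a, rfl, -⟩ := h b hb
      exact ⟨a, hb, rfl⟩
  have h₁ := Set.ncard_add_ncard_compl (p ⁻¹' T)
  have h₂ := Set.ncard_add_ncard_compl T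
  have h₃ : ((p ⁻¹' T)ᶜ).ncard = (Tᶜ).ncard := by
    rw [← hbij.image_eq, hbij.injOn.ncard_image]
  omega

/-- The map on rational points induced by a morphism of `k`-schemes. -/
noncomputable def RationalPoints.map {k : Type u} [Field k] {X Y : Scheme.{u}} {s : X ⟶ Spec (CommRingCat.of k)}
    {t : Y ⟶ Spec (CommRingCat.of k)} (f : X ⟶ Y) (hf : f ≫ t = s) (L : Type u) [Field L]
    [Algebra k L] (x : RationalPoints s L) : RationalPoints t L :=
  ⟨x.1 ≫ f, by rw [Category.assoc, hf, x.2]⟩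

lemma RationalPoints.map_injective {k : Type u} [Field k] {X Y : Scheme.{u}}
    {s : X ⟶ Spec (CommRingCat.of k)} {t : Y ⟶ Spec (CommRingCat.of k)} (f : X ⟶ Y) [Mono f]
    (hf : f ≫ t = s) (L : Type u) [Field L] [Algebra k L] :
    Function.Injective (RationalPoints.map f hf L) := fun _ _ h ↦
  Subtype.ext ((cancel_mono f).mp (congrArg Subtype.val h))

/-- Lifting is a condition on the image point alone; the lift is automatically over `k`. Points of a
subscheme can thus be counted inside the ambient scheme. -/
lemma RationalPoints.range_map_of_isPreimmersion {k : Type u} [Field k] {X Y : Scheme.{u}}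
    {s : X ⟶ Spec (CommRingCat.of k)} {t : Y ⟶ Spec (CommRingCat.of k)} (f : X ⟶ Y)
    [IsPreimmersion f] (hf : f ≫ t = s) (L : Type u) [Field L] [Algebra k L] :
    Set.range (RationalPoints.map f hf L) = {y | y.1 (closedPoint L) ∈ Set.range f} := by
  ext y
  constructor
  · rintro ⟨x, rfl⟩
    exact ⟨x.1 (closedPoint L), rfl⟩
  · intro hy
    obtain ⟨g, hg⟩ := IsPreimmersion.exists_comp_eq f y.1 hy
    exact ⟨⟨g, by rw [← hf, reassoc_of% hg, y.2]⟩, Subtype.ext hg⟩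

lemma RationalPoints.natCard_eq_of_isPreimmersion {k : Type u} [Field k] {X Y : Scheme.{u}}
    {s : X ⟶ Spec (CommRingCat.of k)} {t : Y ⟶ Spec (CommRingCat.of k)} (f : X ⟶ Y)
    [IsPreimmersion f] (hf : f ≫ t = s) (L : Type u) [Field L] [Algebra k L] :
    Nat.card (RationalPoints s L) =
      {y : RationalPoints t L | y.1 (closedPoint L) ∈ Set.range f}.ncard := by
  rw [← RationalPoints.range_map_of_isPreimmersion f hf L, ← Set.image_univ,
    Set.ncard_image_of_injective _ (RationalPoints.map_injective f hf L), Set.ncard_univ]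

end Counting

/-! ### The point count -/

theorem theorem4 {k : Type u} [Field k] [Finite k]
    -- the projective plane curve `X`: an integral closed subscheme of `ℙ²` of dimension one
    (X : Scheme.{u}) [IsIntegral X] (e : X ⟶ projPlane k) [IsClosedImmersion e]
    (hdim : topologicalKrullDim X = 1)
    -- the subscheme `Z` of `X`, containing the singular subscheme
    (Z : Scheme.{u}) (i : Z ⟶ X) [IsImmersion i]
    (hZ : ∃ j : singularSubscheme X ⟶ Z, j ≫ i = singularSubschemeι X)
    -- the extension of `k` of degree `r`
    (r : ℕ) (hr : 1 ≤ r) (L : Type u) [Field L] [Algebra k L] (hL : Module.finrank k L = r)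
    -- the structure morphisms of `X`, its normalisation `X̃`, `Z`, and `Z̃ = π⁻¹(Z)`
    (sX : X ⟶ Spec (CommRingCat.of k)) (hsX : sX = toSpecBase e)
    (sXt : normalisation X ⟶ Spec (CommRingCat.of k)) (hsXt : sXt = normalisationMap X ≫ sX)
    (sZ : Z ⟶ Spec (CommRingCat.of k)) (hsZ : sZ = i ≫ sX)
    (sZt : pullback (normalisationMap X) i ⟶ Spec (CommRingCat.of k))
    (hsZt : sZt = pullback.fst (normalisationMap X) i ≫ sXt) :
    Finite (RationalPoints sXt L) ∧ Finite (RationalPoints sX L) ∧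
      Finite (RationalPoints sZt L) ∧ Finite (RationalPoints sZ L) ∧
      (Nat.card (RationalPoints sXt L) : ℤ) - (Nat.card (RationalPoints sX L) : ℤ) =
        (Nat.card (RationalPoints sZt L) : ℤ) - (Nat.card (RationalPoints sZ L) : ℤ) := by
  -- `Module.finrank` is `0` for infinite extensions, so `1 ≤ r` excludes them.
  have : Module.Finite k L := Module.finite_of_finrank_pos (by omega)
  have : Finite L := Module.finite_of_finite k
  have : LocallyOfFiniteType sX := by
    rw [hsX]; unfold toSpecBase; infer_instance
  have : QuasiCompact sX := by
    rw [hsX]; unfold toSpecBase; infer_instance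
  have hfinX : Finite (RationalPoints sX L) := finite_rationalPoints sX L
  let p : RationalPoints sXt L → RationalPoints sX L :=
    RationalPoints.map (normalisationMap X) hsXt.symm L
  have hfinXt : Finite (RationalPoints sXt L) := by
    have (f : RationalPoints sX L) := finite_comp_normalisationMap_eq X sX hdim.le f.1
    let G : RationalPoints sXt L →
        Σ f : RationalPoints sX L, {g // g ≫ normalisationMap X = f.1} := fun g ↦ ⟨p g, g.1, rfl⟩
    refine Finite.of_injective G fun g g' h ↦ Subtype.ext ?_
    exact congrArg (fun x : Σ f : RationalPoints sX L, {g // g ≫ normalisationMap X = f.1} ↦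
      x.2.1) h
  have hsing : singularPoints X ⊆ Set.range i := by
    obtain ⟨j, hj⟩ := hZ
    intro x hx
    have : x ∈ Set.range (singularSubschemeι X) := by
      rw [singularSubschemeι, Scheme.IdealSheafData.range_subschemeι]
      simpa [singularIdeal] using subset_closure hx
    obtain ⟨y, rfl⟩ := this
    rw [← hj]
    exact ⟨j y, rfl⟩
  refine ⟨hfinXt, hfinX,
    Finite.of_injective _ (RationalPoints.map_injective (pullback.fst _ _) hsZt.symm L),
    Finite.of_injective _ (RationalPoints.map_injective i hsZ.symm L), ?_⟩
  rw [RationalPoints.natCard_eq_of_isPreimmersion (pullback.fst _ _) hsZt.symm L,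
    RationalPoints.natCard_eq_of_isPreimmersion i hsZ.symm L,
    natCard_sub_natCard_eq_of_existsUnique p
      {y | y.1 (IsLocalRing.closedPoint L) ∈ Set.range i} fun f hf ↦ ?_]
  · congr 3
    ext y
    -- The range of the projection is the preimage of the range of `i`.
    rw [Scheme.Pullback.range_fst]
    rfl
  · obtain ⟨g, hg, huniq⟩ := existsUnique_comp_normalisationMap X hdim.le f.1 fun h ↦ hf (hsing h)
    refine ⟨⟨g, by rw [hsXt, reassoc_of% hg, f.2]⟩, Subtype.ext hg, fun g' hg' ↦ ?_⟩
    exact Subtype.ext (huniq _ (congrArg Subtype.val hg'))
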